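/- For $a\in\mathbb C$ let $f_a(z)=e^z+a$. The Fatou set $F(f_a)$ is the set of points of $\mathbb C$ having a neighbourhood on which the family of iterates $(f_a^n)_{n\ge 1}$ is normal (limit function $\infty$ allowed), and $J(f_a)=\mathbb C\setminus F(f_a)$ is the Julia set. For $r>0$ let $M(r,f_a)=\max_{|z|=r}|f_a(z)|$, let $M^n(\cdot,f_a)$ be the $n$-th iterate of $r\mapsto M(r,f_a)$, and for $R>0$ put $$A_R(f_a)=\{z\in\mathbb C:\ |f_a^n(z)|\ge M^n(R,f_a)\ \text{for all } n\ge 0\}.$$ A set $E\subset\mathbb C\cup\{\infty\}$ separates two points $x,y$ of the Riemann sphere $\mathbb C\cup\{\infty\}$ if the space $(\mathbb C\setminus E)\cup\{x,y\}$, with the topology induced from the sphere, has a closed and open subset that contains $x$ but not $y$. **Theorem (Points staying away from the singular value).** Let $a\in\mathbb C$ with $a\in J(f_a)$, let $\varepsilon>0$ and $R>0$, and let $S$ be the set of points $z\in\mathbb C$ with $$\inf_{n\ge 0}|f_a^n(z)-a|>\varepsilon.$$ Then every point $z_0\in S$ is separated from $\infty$ by $A_R(f_a)\cup(\mathbb C\setminus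 S)$. -/

import Mathlib

open Filter Topology

/-- The exponential map `f_a(z) = e^z + a`. -/
noncomputable def expMap (a : ℂ) : ℂ → ℂ := fun z => Complex.exp z + a

/-- `g k → ∞` locally uniformly on `U` (formulated on compact subsets of `U`). -/
def TendstoInftyLocallyUniformlyOn (g : ℕ → ℂ → ℂ) (U : Set ℂ) : Prop :=
  ∀ K ⊆ U, IsCompact K → ∀ C : ℝ, ∀ᶠ k in atTop, ∀ z ∈ K, C < ‖g k z‖

/-- Normality of a family of (holomorphic) functions on a domain `U`: every sequence in the family
has a subsequence which converges locally uniformly on `U`, either to a finite limit function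
(which is then automatically holomorphic when the family is) or to `∞`. -/
def IsNormalFamilyOn (𝓕 : Set (ℂ → ℂ)) (U : Set ℂ) : Prop :=
  ∀ g : ℕ → ℂ → ℂ, (∀ k, g k ∈ 𝓕) →
    ∃ φ : ℕ → ℕ, StrictMono φ ∧
      ((∃ h : ℂ → ℂ, TendstoLocallyUniformlyOn (fun k => g (φ k)) h atTop U) ∨
        TendstoInftyLocallyUniformlyOn (fun k => g (φ k)) U)

/-- The Fatou set of an entire function `f`: the set of points having a neighbourhood (which may be
taken to be a domain) on which the family of iterates `(f^n)_{n ≥ 1}` is normal. -/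
def fatouSet (f : ℂ → ℂ) : Set ℂ :=
  {z | ∃ U : Set ℂ, IsOpen U ∧ IsConnected U ∧ z ∈ U ∧
    IsNormalFamilyOn {g | ∃ n : ℕ, 1 ≤ n ∧ g = f^[n]} U}

/-- The Julia set, the complement of the Fatou set in `ℂ`. -/
def juliaSet (f : ℂ → ℂ) : Set ℂ := (fatouSet f)ᶜ

/-- The maximum modulus `M(r, f) = max_{|z| = r} |f(z)|`; for continuous `f` and `r ≥ 0` the
supremum is attained. -/
noncomputable def maxModulus (f : ℂ → ℂ) (r : ℝ) : ℝ :=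
  sSup ((fun z => ‖f z‖) '' Metric.sphere (0 : ℂ) r)

/-- `A_R(f) = {z : |f^n(z)| ≥ M^n(R, f) for all n}`, where `M^n(·, f)` is the `n`-th iterate of
`r ↦ M(r, f)`. -/
def fastEscapingSet (f : ℂ → ℂ) (R : ℝ) : Set ℂ :=
  {z | ∀ n : ℕ, (maxModulus f)^[n] R ≤ ‖f^[n] z‖}

/-- The points whose orbit stays at distance more than `ε` from `a`, uniformly:
`inf_{n ≥ 0} |f^n(z) - a| > ε`. -/
def avoidingSet (f : ℂ → ℂ) (a : ℂ) (ε : ℝ) : Set ℂ :=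
  {z | ε < ⨅ n : ℕ, ‖f^[n] z - a‖}

/-- Two points of a topological space `X` are separated (in `X`) if some clopen subset of `X`
contains the first but not the second. -/
def AreSeparated {X : Type*} [TopologicalSpace X] (x y : X) : Prop :=
  ∃ U : Set X, IsClopen U ∧ x ∈ U ∧ y ∉ U

/-- A subset `E` of the Riemann sphere separates `x` from `y` if `x` and `y` are separated in the
space `(ℂ \ E) ∪ {x, y}`, with the subspace topology of the sphere. -/
def Separates (E : Set (OnePoint ℂ)) (x y : OnePoint ℂ) : Prop :=
  AreSeparated
    (X := ↥((Set.range ((↑) : ℂ → OnePoint ℂ) \ E) ∪ {x, y} : Set (OnePoint ℂ)))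
    ⟨x, Or.inr (Or.inl rfl)⟩ ⟨y, Or.inr (Or.inr rfl)⟩

/-! Let X be the closed, forward invariant set of points whose orbits keep distance at least ε from
a. The key is a branch ℓ of log(w - a) on X with |Im ℓ| ≤ B. Given it, z - ℓ(f z) ∈ 2πiℤ on X, so
μ(z) = Im(z - ℓ(f z)) is locally constant there and within B of Im z: bounds on Im z become clopen
conditions. Let V be the points of X whose n-th iterate lies, for every n, in the box |μ| ≤ r_n + B,
Re < r_n + 2, where r_{n+1} = e^{r_n} + |a|. At points of X with |f^k(z)| < r_k for some k,
membership in V is locally constant (`exists_bounded_locally_constant`): only finitely many n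
matter, and an iterate too far to the right for its box is thrown outside the next one.

The branch comes from a ∈ J. Iterates of D(a, ε) staying in a right half-plane would form a normal
family, so some p in the disc is sent into a left half-plane that misses X. Pulling a leftward ray
back by logarithms gives a curve from p to +∞ inside narrow cones, disjoint from X
(`exists_conicCurve_expMap`). Slitting along it bounds the argument, and a segment in the disc moves
the base point from p to a (`hasBoundedLog_farOrbitSet`). -/

/-! ### Conic curves and their logarithmic lifts. -/

/-- A curve that runs off to `+∞` inside arbitrarily narrow horizontal cones. -/
structure IsConicCurve (g : ℝ → ℂ) : Prop where
  continuous : Continuous g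
  tendsto_re : Tendsto (fun t => (g t).re) atTop atTop
  cone : ∀ δ > 0, ∃ T, ∀ s t, T ≤ s → s ≤ t → |(g t - g s).im| ≤ δ * (g t - g s).re

theorem IsConicCurve.sub_const {g : ℝ → ℂ} (hg : IsConicCurve g) (a : ℂ) :
    IsConicCurve (fun t => g t - a) where
  continuous := hg.continuous.sub continuous_const
  tendsto_re := by
    simpa [sub_eq_add_neg] using tendsto_atTop_add_const_right atTop (-a.re) hg.tendsto_re
  cone := by simpa using hg.cone

theorem isConicCurve_add_max (b : ℂ) : IsConicCurve (fun t => b + (max t 0 : ℝ)) where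
  continuous := by fun_prop
  tendsto_re := by
    simp only [Complex.add_re, Complex.ofReal_re]
    exact tendsto_atTop_add_const_left _ _
      (tendsto_atTop_mono (fun t => le_max_left t 0) tendsto_id)
  cone := fun δ hδ => ⟨0, fun s t _ hst => by
    have : max s 0 ≤ max t 0 := max_le_max hst le_rfl
    simp only [add_sub_add_left_eq_sub, Complex.sub_im, Complex.ofReal_im, sub_self, abs_zero,
      Complex.sub_re, Complex.ofReal_re]
    exact mul_nonneg hδ.le (sub_nonneg.2 this)⟩

/-- With x = Re z, both parts compare with 1 + x: |arg(1 + z)| ≤ |Im z|/(1 + x) and log|1 + z| ≥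
x/(1 + x). -/
theorem Complex.abs_log_one_add_im_le {z : ℂ} {δ : ℝ} (hδ : 0 < δ) (hz : |z.im| ≤ δ * z.re) :
    |(Complex.log (1 + z)).im| ≤ δ * (Complex.log (1 + z)).re := by
  have hx : 0 ≤ z.re := by
    have := (abs_nonneg _).trans hz
    exact nonneg_of_mul_nonneg_right this hδ
  have h1 : (0 : ℝ) < 1 + z.re := by linarith
  rw [Complex.log_re, Complex.log_im]
  have hre : 1 + z.re ≤ ‖1 + z‖ := by simpa using Complex.re_le_norm (1 + z)
  have harg : |Complex.arg (1 + z)| ≤ |z.im| / (1 + z.re) := by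
    have hlt : |Complex.arg (1 + z)| < Real.pi / 2 :=
      Complex.abs_arg_lt_pi_div_two_iff.2 (Or.inl (by simpa using h1))
    refine (Real.le_tan (abs_nonneg _) hlt).trans (le_of_eq ?_)
    have htan := Complex.tan_arg (1 + z)
    simp only [Complex.add_im, Complex.one_im, zero_add, Complex.add_re, Complex.one_re] at htan
    have h2 : 0 ≤ Real.tan |Complex.arg (1 + z)| :=
      Real.tan_nonneg_of_nonneg_of_le_pi_div_two (abs_nonneg _) hlt.le
    have h3 : |Real.tan (Complex.arg (1 + z))| = Real.tan |Complex.arg (1 + z)| := by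
      rcases abs_choice (Complex.arg (1 + z)) with h | h
      · nth_rewrite 1 [← h]
        exact abs_of_nonneg h2
      · rw [← abs_of_nonneg h2, h, Real.tan_neg, abs_neg]
    rw [← h3, htan, abs_div, abs_of_pos h1]
  have hlog : z.re / (1 + z.re) ≤ Real.log ‖1 + z‖ := by
    refine le_trans ?_ (Real.log_le_log h1 hre)
    have := Real.one_sub_inv_le_log_of_pos h1
    refine le_trans (le_of_eq ?_) this
    field_simp
    ring
  calc _ ≤ |z.im| / (1 + z.re) := harg
    _ ≤ δ * z.re / (1 + z.re) := by gcongr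
    _ = δ * (z.re / (1 + z.re)) := by ring
    _ ≤ _ := by gcongr

/-- The cone condition from a fixed base time forces arg g(s) → 0, so dividing by g(s) tilts a
narrow cone only slightly. -/
theorem IsConicCurve.div_cone {g : ℝ → ℂ} (hg : IsConicCurve g) {δ : ℝ} (hδ : 0 < δ) :
    ∃ T, ∀ s t, T ≤ s → s ≤ t →
      |((g t - g s) / g s).im| ≤ δ * ((g t - g s) / g s).re := by
  set η := min δ 1 / 4 with hη
  have hη0 : 0 < η := by positivity
  have hη1 : η ≤ 1 / 4 := by rw [hη]; linarith [min_le_right δ 1]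
  have hηδ : 4 * η ≤ δ := by rw [hη]; linarith [min_le_left δ 1]
  obtain ⟨T, hT⟩ := hg.cone η hη0
  have hlarge := hg.tendsto_re.eventually_ge_atTop (|(g T).im| / η + |(g T).re| + 1)
  obtain ⟨T', hT'⟩ := eventually_atTop.1 hlarge
  refine ⟨max T T', fun s t hs hst => ?_⟩
  have h1 := hT T s le_rfl (le_of_max_le_left hs)
  have h2 := hT s t (le_of_max_le_left hs) hst
  have h3 := hT' s (le_of_max_le_right hs)
  have hX : 0 < (g s).re := by
    have : 0 ≤ |(g T).im| / η := by positivity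
    linarith [abs_nonneg (g T).re]
  have hY : |(g s).im| ≤ 2 * η * (g s).re := by
    have e1 : |(g s).im| ≤ |(g s - g T).im| + |(g T).im| := by
      have := abs_add_le (g s - g T).im (g T).im
      simpa using this
    have e2 : |(g T).im| ≤ η * ((g s).re - |(g T).re|) := by
      have : |(g T).im| = η * (|(g T).im| / η) := by field_simp
      rw [this]
      gcongr
      linarith
    have e3 : (g s - g T).re ≤ (g s).re + |(g T).re| := by
      simp only [Complex.sub_re]; linarith [neg_abs_le (g T).re]
    have e4 : η * (g s - g T).re ≤ η * ((g s).re + |(g T).re|) := by gcongr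
    nlinarith
  generalize g t - g s = z at *
  generalize g s = w at *
  have hP : 0 ≤ z.re := nonneg_of_mul_nonneg_right ((abs_nonneg _).trans h2) hη0
  have hN : 0 < Complex.normSq w := by
    rw [Complex.normSq_pos]; rintro rfl; simp at hX
  have b1 : |z.im * w.re - z.re * w.im| ≤ 3 * η * (z.re * w.re) := by
    calc _ ≤ |z.im * w.re| + |z.re * w.im| := abs_sub _ _
      _ = |z.im| * w.re + z.re * |w.im| := by
        rw [abs_mul, abs_mul, abs_of_pos hX, abs_of_nonneg hP]
      _ ≤ (η * z.re) * w.re + z.re * (2 * η * w.re) := by gcongr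
      _ = _ := by ring
  have b2 : (7 / 8) * (z.re * w.re) ≤ z.re * w.re + z.im * w.im := by
    have : |z.im * w.im| ≤ (η * z.re) * (2 * η * w.re) := by
      rw [abs_mul]; gcongr
    have h4 : (η * z.re) * (2 * η * w.re) ≤ 1 / 8 * (z.re * w.re) := by
      have : η * η ≤ 1 / 16 := by nlinarith
      have := mul_le_mul_of_nonneg_right this (mul_nonneg hP hX.le)
      nlinarith
    linarith [neg_abs_le (z.im * w.im)]
  have hre : (z / w).re = (z.re * w.re + z.im * w.im) / Complex.normSq w := by
    rw [Complex.div_re]; ring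
  have him : (z / w).im = (z.im * w.re - z.re * w.im) / Complex.normSq w := by
    rw [Complex.div_im]; ring
  rw [hre, him, abs_div, abs_of_pos hN, ← mul_div_assoc]
  gcongr
  have hzw := mul_nonneg hP hX.le
  calc _ ≤ 3 * η * (z.re * w.re) := b1
    _ ≤ 4 * η * (7 / 8 * (z.re * w.re)) := by nlinarith [mul_nonneg hη0.le hzw]
    _ ≤ δ * (7 / 8 * (z.re * w.re)) := by gcongr
    _ ≤ _ := by gcongr

/-- Logarithmic lifts of conic curves are conic. -/
theorem IsConicCurve.of_exp_eq {g h : ℝ → ℂ} (hg : IsConicCurve g) {κ : ℂ} (hκ : κ ≠ 0)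
    (hh : Continuous h) (he : ∀ t, Complex.exp (h t) = κ * g t) : IsConicCurve h := by
  have hg0 : ∀ t, g t ≠ 0 := fun t h0 => Complex.exp_ne_zero (h t) (by rw [he, h0, mul_zero])
  refine ⟨hh, ?_, fun δ hδ => ?_⟩
  · have hr : ∀ t, (h t).re = Real.log ‖κ * g t‖ := fun t => by
      rw [← he, Complex.norm_exp, Real.log_exp]
    simp only [hr, norm_mul]
    refine Real.tendsto_log_atTop.comp (Tendsto.const_mul_atTop (norm_pos_iff.2 hκ) ?_)
    exact tendsto_atTop_mono (fun t => Complex.re_le_norm _) hg.tendsto_re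
  · obtain ⟨T, hT⟩ := hg.div_cone hδ
    refine ⟨T, fun s t hs hst => ?_⟩
    have hpos : ∀ t, s ≤ t → 0 < (1 + (g t - g s) / g s).re := fun t ht => by
      have := nonneg_of_mul_nonneg_right ((abs_nonneg _).trans (hT s t hs ht)) hδ
      simp only [Complex.add_re, Complex.one_re]; linarith
    -- Both sides lift the same curve through exp and agree at s; uniqueness of lifts identifies
    -- them.
    have key : Set.EqOn h (fun t => h s + Complex.log (1 + (g t - g s) / g s)) (Set.Ici s) := by
      refine Complex.isCoveringMap_exp.eqOn_of_comp_eqOn isPreconnected_Ici hh.continuousOn ?_ ?_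
        (Set.self_mem_Ici) ?_
      · refine continuousOn_const.add (ContinuousOn.clog ?_ fun t ht => Or.inl (hpos t ht))
        exact (continuous_const.add
          ((hg.continuous.sub continuous_const).div_const _)).continuousOn
      · intro t ht
        refine Subtype.ext ?_
        have hne : 1 + (g t - g s) / g s ≠ 0 := fun h0 => by
          have := hpos t ht; rw [h0] at this; simp at this
        simp only [Function.comp_apply, Complex.exp_add, Complex.exp_log hne, he]
        have := hg0 s
        field_simp
        ring
      · simp
    rw [key hst, add_sub_cancel_left]
    exact Complex.abs_log_one_add_im_le hδ (hT s t hs hst)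

/-- Continuous logarithms along curves. -/
theorem exists_continuous_exp_eq {g : ℝ → ℂ} (hg : Continuous g) (h0 : ∀ t, g t ≠ 0) {y : ℂ}
    (hy : Complex.exp y = g 0) : ∃ h : ℝ → ℂ, Continuous h ∧ h 0 = y ∧
      ∀ t, Complex.exp (h t) = g t := by
  obtain ⟨F, ⟨hF0, hF⟩, -⟩ := Complex.isCoveringMapOn_exp.existsUnique_continuousMap_lifts
    ⟨g, hg⟩ (a₀ := (0 : ℝ)) (e₀ := y) hy h0
  exact ⟨F, F.continuous, hF0, fun t => congrFun hF t⟩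

/-- Each pullback takes a logarithm of γ - a, which needs γ to avoid a; the bound on the orbit of a
ensures this. -/
theorem exists_conicCurve_expMap {a : ℂ} {c : ℝ} (hc : c ≤ a.re) (k : ℕ) :
    ∀ y : ℂ, ((expMap a)^[k + 1] y).re < c →
      (∀ i, 1 ≤ i → i < k + 1 → c ≤ ((expMap a)^[i] a).re) →
      ∃ γ : ℝ → ℂ, IsConicCurve γ ∧ γ 0 = y ∧ ∀ t, ((expMap a)^[k + 1] (γ t)).re < c := by
  induction k with
  | zero =>
    intro y hy _
    simp only [zero_add, Function.iterate_one] at hy ⊢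
    -- The leftward ray from e^y, negated to be conic. It avoids 0 because Re f(y) < c ≤ Re a gives
    -- Re e^y < 0.
    have hb := isConicCurve_add_max (-Complex.exp y)
    have hre : (Complex.exp y).re < 0 := by
      simp only [expMap, Complex.add_re] at hy; linarith
    obtain ⟨h, hh, h0, he⟩ := exists_continuous_exp_eq (y := y)
      (g := fun t => -1 * (-Complex.exp y + (max t 0 : ℝ)))
      (continuous_const.mul hb.continuous) (fun t h0 => by
        have := congrArg Complex.re h0
        simp only [neg_mul, one_mul, Complex.neg_re, Complex.add_re, Complex.ofReal_re,
          Complex.zero_re] at this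
        linarith [le_max_right t 0]) (by simp)
    refine ⟨h, hb.of_exp_eq (neg_ne_zero.2 one_ne_zero) hh he, h0, fun t => ?_⟩
    simp only [expMap, he, neg_mul, one_mul, neg_add, neg_neg, Complex.add_re, Complex.neg_re,
      Complex.ofReal_re] at hy ⊢
    linarith [le_max_right t 0]
  | succ k ih =>
    intro y hy ha
    rw [Function.iterate_succ_apply] at hy
    obtain ⟨γ, hγ, h0, hk⟩ := ih (expMap a y) hy fun i h1 h2 => ha i h1 (by omega)
    have hne : ∀ t, γ t - a ≠ 0 := fun t h => by
      have h1 := hk t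
      rw [sub_eq_zero.1 h] at h1
      exact absurd h1 (not_lt.2 (ha (k + 1) (by omega) (by omega)))
    obtain ⟨h, hh, hh0, he⟩ := exists_continuous_exp_eq (y := y) (hγ.sub_const a).continuous hne
      (by rw [h0, expMap, add_sub_cancel_right])
    refine ⟨h, (hγ.sub_const a).of_exp_eq one_ne_zero hh (by simpa using he), hh0, fun t => ?_⟩
    rw [Function.iterate_succ_apply, expMap, he, sub_add_cancel]
    exact hk t

/-! ### Logarithms with bounded imaginary part. -/

/-- A branch of `w ↦ log (w - y)` with bounded imaginary part exists on `X`. -/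
def HasBoundedLog (X : Set ℂ) (y : ℂ) : Prop :=
  ∃ ℓ : ℂ → ℂ, ContinuousOn ℓ X ∧ (∃ B : ℝ, ∀ w ∈ X, |(ℓ w).im| ≤ B) ∧
    ∀ w ∈ X, Complex.exp (ℓ w) = w - y

theorem Complex.div_mem_slitPlane_of_notMem_segment {w y y' : ℂ} (hw : w ∉ segment ℝ y y') :
    (w - y) / (w - y') ∈ Complex.slitPlane := by
  by_contra h
  rw [Complex.mem_slitPlane_iff, not_or, not_lt, not_not] at h
  obtain ⟨hre, him⟩ := h
  have hy' : w - y' ≠ 0 := fun h0 => hw (by rw [sub_eq_zero.1 h0]; exact right_mem_segment _ _ _)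
  set s : ℝ := -((w - y) / (w - y')).re with hs
  have hs0 : 0 ≤ s := by rw [hs]; linarith
  have hq : (w - y) / (w - y') = -(s : ℂ) := by
    apply Complex.ext <;> simp [hs, him]
  rw [div_eq_iff hy'] at hq
  refine hw ⟨1 / (1 + s), s / (1 + s), by positivity, by positivity, by field_simp, ?_⟩
  have h1 : (1 + s : ℂ) ≠ 0 := by
    have : (1 + s : ℝ) ≠ 0 := by positivity
    exact_mod_cast this
  simp only [Complex.real_smul]
  push_cast
  field_simp
  linear_combination -hq

/-- The quotient (w - y)/(w - y') avoids (-∞, 0] off the segment, so its principal logarithm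
corrects ℓ at a cost of at most π. -/
theorem HasBoundedLog.of_segment {X : Set ℂ} {y y' : ℂ} (h : HasBoundedLog X y')
    (hd : Disjoint (segment ℝ y y') X) : HasBoundedLog X y := by
  obtain ⟨ℓ, hc, ⟨B, hB⟩, he⟩ := h
  have hns : ∀ w ∈ X, w ∉ segment ℝ y y' := fun w hw hs => Set.disjoint_left.1 hd hs hw
  have hy : ∀ w ∈ X, w - y ≠ 0 := fun w hw h0 =>
    hns w hw (by rw [sub_eq_zero.1 h0]; exact left_mem_segment _ _ _)
  have hy' : ∀ w ∈ X, w - y' ≠ 0 := fun w hw h0 =>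
    hns w hw (by rw [sub_eq_zero.1 h0]; exact right_mem_segment _ _ _)
  refine ⟨fun w => ℓ w + Complex.log ((w - y) / (w - y')), ?_, ⟨B + Real.pi, ?_⟩, ?_⟩
  · refine hc.add (ContinuousOn.clog (ContinuousOn.div (by fun_prop) (by fun_prop) hy') ?_)
    exact fun w hw => Complex.div_mem_slitPlane_of_notMem_segment (hns w hw)
  · intro w hw
    rw [Complex.add_im]
    refine (abs_add_le _ _).trans (add_le_add (hB w hw) ?_)
    rw [Complex.log_im]
    exact Complex.abs_arg_le_pi _
  · intro w hw
    rw [Complex.exp_add, he w hw, Complex.exp_log (div_ne_zero (hy w hw) (hy' w hw)),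
      mul_div_cancel₀ _ (hy' w hw)]

/-- Short segments make the property locally constant off X. The bound may change along C, so C need
not be compact. -/
theorem HasBoundedLog.of_isPreconnected {X C : Set ℂ} (hX : IsClosed X) (hC : IsPreconnected C)
    (hCX : Disjoint C X) {y y' : ℂ} (hy : y ∈ C) (hy' : y' ∈ C) (h : HasBoundedLog X y) :
    HasBoundedLog X y' := by
  have hball : ∀ z ∉ X, ∃ r > 0, ∀ u ∈ Metric.ball z r, ∀ v ∈ Metric.ball z r,
      Disjoint (segment ℝ u v) X := fun z hz => by
    obtain ⟨r, hr, hsub⟩ := Metric.isOpen_iff.1 hX.isOpen_compl z hz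
    exact ⟨r, hr, fun u hu v hv => Set.disjoint_left.2 fun w hw =>
      hsub ((convex_ball z r).segment_subset hu hv hw)⟩
  have key : ∀ P : ℂ → Prop, (∀ u v, Disjoint (segment ℝ u v) X → P v → P u) →
      IsOpen {z | z ∉ X ∧ P z} := fun P hP => Metric.isOpen_iff.2 fun z hz => by
    obtain ⟨r, hr, hb⟩ := hball z hz.1
    refine ⟨r, hr, fun u hu => ⟨fun hu' => ?_, hP u z (hb u hu z (Metric.mem_ball_self hr)) hz.2⟩⟩
    exact Set.disjoint_left.1 (hb u hu u hu) (left_mem_segment _ _ _) hu'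
  have h1 := key (HasBoundedLog X) fun u v hd hv => hv.of_segment hd
  have h2 := key (fun z => ¬ HasBoundedLog X z) fun u v hd hv hu =>
    hv (hu.of_segment (by rwa [segment_symm]))
  have hsub := hC.subset_left_of_subset_union h1 h2
    (Set.disjoint_left.2 fun z hz hz' => hz'.2 hz.2)
    (fun z hz => by
      have := Set.disjoint_left.1 hCX hz
      by_cases hz' : HasBoundedLog X z
      · exact Or.inl ⟨this, hz'⟩
      · exact Or.inr ⟨this, hz'⟩)
    ⟨y, hy, Set.disjoint_left.1 hCX hy, h⟩
  exact (hsub hy').2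

/-- A set disjoint from a graph over a right half-line carries a bounded logarithm based at the
endpoint of the graph. -/
theorem hasBoundedLog_of_graph {X : Set ℂ} {g : ℝ → ℝ} (hg : Continuous g) {x₀ : ℝ}
    (hX : ∀ x, x₀ ≤ x → (⟨x, g x⟩ : ℂ) ∉ X) : HasBoundedLog X ⟨x₀, g x₀⟩ := by
  -- A shear straightening the graph to [0, ∞). It need only be continuous.
  set σ : ℂ → ℂ := fun w => w - (x₀ : ℂ) - (g w.re : ℂ) * Complex.I with hσ
  have hσc : Continuous σ := by
    have := Complex.continuous_ofReal.comp (hg.comp Complex.continuous_re)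
    exact (continuous_id.sub continuous_const).sub (this.mul continuous_const)
  have hσre : ∀ w, (σ w).re = w.re - x₀ := fun w => by simp [hσ]
  have hσim : ∀ w, (σ w).im = w.im - g w.re := fun w => by simp [hσ]
  have hslit : ∀ w ∈ X, -σ w ∈ Complex.slitPlane := fun w hw => by
    by_contra h
    rw [Complex.mem_slitPlane_iff, not_or, not_lt, not_not, Complex.neg_re, Complex.neg_im,
      neg_eq_zero, hσre, hσim] at h
    refine hX w.re (by linarith [h.1]) ?_
    have : (⟨w.re, g w.re⟩ : ℂ) = w := Complex.ext rfl (by linarith [h.2])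
    rwa [this]
  have hσ0 : ∀ w ∈ X, σ w ≠ 0 := fun w hw h0 => by
    have := hslit w hw
    rw [h0, neg_zero] at this
    exact Complex.zero_notMem_slitPlane this
  -- w - y and σ w have equal real parts, so a real ratio ≤ 0 would force both real parts, and then
  -- σ w, to vanish.
  have hslit' : ∀ w ∈ X, (w - ⟨x₀, g x₀⟩) / σ w ∈ Complex.slitPlane := fun w hw => by
    by_contra h
    rw [Complex.mem_slitPlane_iff, not_or, not_lt, not_not] at h
    obtain ⟨hre, him⟩ := h
    set ρ : ℝ := ((w - ⟨x₀, g x₀⟩) / σ w).re with hρ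
    have hq : (w - ⟨x₀, g x₀⟩) / σ w = (ρ : ℂ) := by
      apply Complex.ext <;> simp [hρ, him]
    rw [div_eq_iff (hσ0 w hw)] at hq
    have e1 := congrArg Complex.re hq
    have e2 := congrArg Complex.im hq
    simp only [Complex.sub_re, Complex.sub_im, Complex.re_ofReal_mul, Complex.im_ofReal_mul, hσre,
      hσim] at e1 e2
    have hu : w.re - x₀ = 0 := by
      have : (1 - ρ) * (w.re - x₀) = 0 := by linarith
      exact (mul_eq_zero.1 this).resolve_left (by linarith)
    have hwre : w.re = x₀ := by linarith
    rw [hwre] at e2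
    have hv : w.im - g x₀ = 0 := by
      have : (1 - ρ) * (w.im - g x₀) = 0 := by linarith
      exact (mul_eq_zero.1 this).resolve_left (by linarith)
    exact hσ0 w hw (Complex.ext (by rw [hσre, hu]; rfl) (by rw [hσim, hwre, hv]; rfl))
  refine ⟨fun w => Complex.log (-σ w) + Complex.log ((w - ⟨x₀, g x₀⟩) / σ w) + Real.pi * Complex.I,
    ?_, ⟨3 * Real.pi, ?_⟩, ?_⟩
  · refine ((ContinuousOn.clog hσc.neg.continuousOn hslit).add (ContinuousOn.clog ?_ hslit')).add
      continuousOn_const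
    exact ContinuousOn.div (by fun_prop) hσc.continuousOn hσ0
  · intro w _
    have h1 := Complex.abs_arg_le_pi (-σ w)
    have h2 := Complex.abs_arg_le_pi ((w - ⟨x₀, g x₀⟩) / σ w)
    simp only [Complex.add_im, Complex.log_im, Complex.mul_im, Complex.ofReal_re, Complex.I_im,
      mul_one, Complex.ofReal_im, Complex.I_re, mul_zero, add_zero]
    rw [abs_le] at *
    constructor <;> linarith [Real.pi_pos]
  · intro w hw
    have h0 := hσ0 w hw
    rw [Complex.exp_add, Complex.exp_add, Complex.exp_log (neg_ne_zero.2 h0),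
      Complex.exp_log (Complex.slitPlane_ne_zero (hslit' w hw)), Complex.exp_pi_mul_I]
    field_simp

/-- The cone condition with δ = 1 makes the tail of the curve a graph of a 1-Lipschitz function. -/
theorem IsConicCurve.exists_hasBoundedLog {γ : ℝ → ℂ} (hγ : IsConicCurve γ) {X : Set ℂ}
    (hX : ∀ t, γ t ∉ X) : ∃ T, HasBoundedLog X (γ T) := by
  obtain ⟨T, hT⟩ := hγ.cone 1 one_pos
  simp only [one_mul] at hT
  have hex : ∀ x : ℝ, ∃ t, T ≤ t ∧ (γ t).re = max x (γ T).re := fun x => by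
    obtain ⟨b, hb, hTb⟩ := ((hγ.tendsto_re.eventually_ge_atTop (max x (γ T).re)).and
      (eventually_ge_atTop T)).exists
    obtain ⟨t, ht, h⟩ := intermediate_value_Icc hTb
      (Complex.continuous_re.comp hγ.continuous).continuousOn ⟨le_max_right x _, hb⟩
    exact ⟨t, ht.1, h⟩
  choose τ hτT hτ using hex
  set g : ℝ → ℝ := fun x => (γ (τ x)).im with hg
  have hlip : ∀ x y, |g x - g y| ≤ |x - y| := by
    have aux : ∀ x y, τ x ≤ τ y → |g x - g y| ≤ |x - y| := fun x y h => by
      have h1 := hT _ _ (hτT x) h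
      rw [abs_sub_comm, abs_sub_comm x]
      simp only [Complex.sub_im, Complex.sub_re, hτ] at h1
      exact h1.trans ((le_abs_self _).trans (abs_max_sub_max_le_abs _ _ _))
    intro x y
    rcases le_total (τ x) (τ y) with h | h
    · exact aux x y h
    · rw [abs_sub_comm, abs_sub_comm x]; exact aux y x h
  have hgc : Continuous g := by
    refine (LipschitzWith.of_dist_le_mul (K := 1) fun x y => ?_).continuous
    simpa [Real.dist_eq] using hlip x y
  have hgT : γ T = ⟨(γ T).re, g (γ T).re⟩ := by
    refine Complex.ext rfl ?_
    have h1 := hT _ _ le_rfl (hτT (γ T).re)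
    simp only [Complex.sub_im, Complex.sub_re, hτ, max_self, sub_self] at h1
    have := abs_nonpos_iff.1 h1
    simp only [hg]
    linarith
  refine ⟨T, ?_⟩
  rw [hgT]
  refine hasBoundedLog_of_graph hgc fun x hx hmem => hX (τ x) ?_
  have : γ (τ x) = ⟨x, g x⟩ := Complex.ext (by rw [hτ, max_eq_left hx]) rfl
  rwa [this]

/-! ### The far-orbit set and its logarithm at a. -/

/-- The points whose orbits stay at distance at least `ε` from `a`. -/
def farOrbitSet (a : ℂ) (ε : ℝ) : Set ℂ :=
  {z | ∀ n : ℕ, ε ≤ ‖(expMap a)^[n] z - a‖}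

theorem continuous_expMap (a : ℂ) : Continuous (expMap a) := by
  unfold expMap; fun_prop

theorem norm_expMap_sub (a z : ℂ) : ‖expMap a z - a‖ = Real.exp z.re := by
  rw [expMap, add_sub_cancel_right, Complex.norm_exp]

theorem isClosed_farOrbitSet (a : ℂ) (ε : ℝ) : IsClosed (farOrbitSet a ε) := by
  simp only [farOrbitSet, Set.ofPred_forall]
  exact isClosed_iInter fun n => isClosed_le continuous_const
    ((((continuous_expMap a).iterate n).sub continuous_const).norm)

theorem iterate_mem_farOrbitSet {a z : ℂ} {ε : ℝ} (hz : z ∈ farOrbitSet a ε) (k : ℕ) :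
    (expMap a)^[k] z ∈ farOrbitSet a ε := fun n => by
  rw [← Function.iterate_add_apply]; exact hz (n + k)

theorem log_le_re_of_mem_farOrbitSet {a z : ℂ} {ε : ℝ} (hε : 0 < ε) (hz : z ∈ farOrbitSet a ε) :
    Real.log ε ≤ z.re := by
  have := hz 1
  rw [Function.iterate_one, norm_expMap_sub] at this
  exact (Real.log_le_iff_le_exp hε).2 this

/-- If some iterate of `D(a, ε)` enters every left half-plane, then the singular value `a` is the
base point of a bounded logarithm on the set of points staying away from it. -/
theorem hasBoundedLog_farOrbitSet {a : ℂ} {ε : ℝ} (hε : 0 < ε)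
    (h : ∀ c : ℝ, ∃ n : ℕ, ∃ p ∈ Metric.ball a ε, ((expMap a)^[n + 1] p).re < c) :
    HasBoundedLog (farOrbitSet a ε) a := by
  classical
  set c := min (Real.log ε) a.re with hc
  have hex : ∃ n : ℕ, ∃ p ∈ Metric.ball a ε, ((expMap a)^[n + 1] p).re < c := h c
  obtain ⟨p, hp, hpc⟩ := Nat.find_spec hex
  have hmin := fun m (hm : m < Nat.find hex) => Nat.find_min hex hm
  generalize Nat.find hex = n at *
  -- Minimality of n, applied to the centre a of the disc, bounds the real parts of its earlier
  -- iterates below.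
  obtain ⟨γ, hγ, h0, hn⟩ := exists_conicCurve_expMap (min_le_right _ _) n p hpc fun i h1 h2 => by
    by_contra hlt
    refine hmin (i - 1) (by omega) ⟨a, Metric.mem_ball_self hε, ?_⟩
    rw [Nat.sub_add_cancel h1]
    exact not_le.1 hlt
  have hX : ∀ t, γ t ∉ farOrbitSet a ε := fun t ht => by
    have := log_le_re_of_mem_farOrbitSet hε (iterate_mem_farOrbitSet ht (n + 1))
    exact absurd ((hn t).trans_le (min_le_left _ _)) (not_lt.2 this)
  obtain ⟨T, hT⟩ := hγ.exists_hasBoundedLog hX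
  have hpL : HasBoundedLog (farOrbitSet a ε) p :=
    hT.of_isPreconnected (isClosed_farOrbitSet a ε)
      (isPreconnected_range hγ.continuous)
      (Set.disjoint_left.2 (by rintro _ ⟨t, rfl⟩; exact hX t)) ⟨T, rfl⟩ ⟨0, h0⟩
  refine hpL.of_segment (Set.disjoint_left.2 fun w hw hwX => ?_)
  have hw' := (convex_ball a ε).segment_subset (Metric.mem_ball_self hε) hp hw
  have h1 := hwX 0
  rw [Metric.mem_ball, dist_eq_norm] at hw'
  exact absurd hw' (not_lt.2 h1)

/-! ### Normality in a right half-plane. -/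

/-- Montel's theorem on a disc: bounded sequences of holomorphic functions have uniformly
convergent subsequences on the concentric disc of half the radius. -/
theorem exists_subseq_tendstoUniformlyOn_of_norm_le {a : ℂ} {r B : ℝ} (hr : 0 < r)
    {u : ℕ → ℂ → ℂ} (hu : ∀ k, DifferentiableOn ℂ (u k) (Metric.ball a r))
    (hB : ∀ k, ∀ z ∈ Metric.ball a r, ‖u k z‖ ≤ B) :
    ∃ φ : ℕ → ℕ, StrictMono φ ∧ ∃ h : ℂ → ℂ,
      TendstoUniformlyOn (fun k => u (φ k)) h atTop (Metric.closedBall a (r / 2)) := by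
  set K := Metric.closedBall a (r / 2) with hK
  have hKr : K ⊆ Metric.ball a r := Metric.closedBall_subset_ball (by linarith)
  have hB0 : 0 ≤ B := (norm_nonneg _).trans (hB 0 a (Metric.mem_ball_self hr))
  have hKc : CompactSpace K := isCompact_iff_compactSpace.1 (isCompact_closedBall a (r / 2))
  have hd : ∀ k, ∀ z ∈ K, ‖deriv (u k) z‖ ≤ B / (r / 4) := fun k z hz => by
    have hsub : Metric.closedBall z (r / 4) ⊆ Metric.ball a r := fun w hw => by
      rw [Metric.mem_closedBall] at hz hw
      rw [Metric.mem_ball]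
      linarith [dist_triangle w z a]
    refine Complex.norm_deriv_le_of_forall_mem_sphere_norm_le (by positivity) ?_ fun w hw =>
      hB k w (hsub (Metric.sphere_subset_closedBall hw))
    exact ((hu k).mono hsub).diffContOnCl_ball subset_rfl
  have hlip : ∀ k, LipschitzWith (B / (r / 4)).toNNReal (fun z : K => u k z) := fun k =>
    LipschitzWith.of_dist_le_mul fun z w => by
      rw [Real.coe_toNNReal _ (by positivity), dist_eq_norm, Subtype.dist_eq, dist_eq_norm]
      exact (convex_closedBall a (r / 2)).norm_image_sub_le_of_norm_deriv_le
        (fun x hx => (hu k).differentiableAt (Metric.isOpen_ball.mem_nhds (hKr hx)))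
        (hd k) w.2 z.2
  set F : ℕ → BoundedContinuousFunction K ℂ := fun k =>
    BoundedContinuousFunction.mkOfCompact ⟨fun z : K => u k z, (hlip k).continuous⟩ with hF
  have hcomp := BoundedContinuousFunction.arzela_ascoli (Metric.closedBall (0 : ℂ) B)
    (isCompact_closedBall _ _) (Set.range F)
    (by
      rintro _ z ⟨k, rfl⟩
      simpa [hF] using hB k z (hKr z.2))
    (by
      refine UniformEquicontinuous.equicontinuous
        (LipschitzWith.uniformEquicontinuous _ (B / (r / 4)).toNNReal ?_)
      rintro ⟨_, k, rfl⟩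
      exact hlip k)
  obtain ⟨G, -, φ, hφ, hG⟩ := hcomp.tendsto_subseq (x := F) fun k => subset_closure ⟨k, rfl⟩
  rw [BoundedContinuousFunction.tendsto_iff_tendstoUniformly] at hG
  classical
  refine ⟨φ, hφ, fun z => if hz : z ∈ K then G ⟨z, hz⟩ else 0, ?_⟩
  rw [tendstoUniformlyOn_iff_tendstoUniformly_comp_coe]
  convert hG using 1
  · rfl
  · ext z
    simp

/-- A family of holomorphic functions with values in a common right half-plane is normal. -/
theorem isNormalFamilyOn_of_le_re {𝓕 : Set (ℂ → ℂ)} {a : ℂ} {r c : ℝ} (hr : 0 < r)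
    (hd : ∀ g ∈ 𝓕, DifferentiableOn ℂ g (Metric.ball a r))
    (hc : ∀ g ∈ 𝓕, ∀ z ∈ Metric.ball a r, c ≤ (g z).re) :
    IsNormalFamilyOn 𝓕 (Metric.ball a (r / 2)) := by
  intro g hg
  set U := Metric.ball a (r / 2) with hU
  have hUr : U ⊆ Metric.ball a r := Metric.ball_subset_ball (by linarith)
  -- The shift gives Re v ≥ 1, so 1/v is bounded by 1. Its limit h has Re h ≥ 0: by the open mapping
  -- theorem it vanishes identically (limit ∞) or nowhere (finite limit).
  set v : ℕ → ℂ → ℂ := fun k z => g k z - (c - 1 : ℝ) with hv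
  have hvre : ∀ k, ∀ z ∈ Metric.ball a r, 1 ≤ (v k z).re := fun k z hz => by
    have := hc _ (hg k) z hz
    simp only [hv, Complex.sub_re, Complex.ofReal_re]
    linarith
  have hv0 : ∀ k, ∀ z ∈ Metric.ball a r, v k z ≠ 0 := fun k z hz h0 => by
    have := hvre k z hz
    rw [h0, Complex.zero_re] at this
    linarith
  have hud : ∀ k, DifferentiableOn ℂ (fun z => (v k z)⁻¹) (Metric.ball a r) := fun k =>
    ((hd _ (hg k)).sub_const _).inv (hv0 k)
  obtain ⟨φ, hφ, h, hh⟩ := exists_subseq_tendstoUniformlyOn_of_norm_le (B := 1) hr hud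
    fun k z hz => by
      rw [norm_inv]
      exact inv_le_one_of_one_le₀ ((hvre k z hz).trans (Complex.re_le_norm _))
  replace hh : TendstoUniformlyOn (fun k z => (v (φ k) z)⁻¹) h atTop U :=
    hh.mono Metric.ball_subset_closedBall
  have hhl := hh.tendstoLocallyUniformlyOn
  have hhd : DifferentiableOn ℂ h U := hhl.differentiableOn
    (Eventually.of_forall fun k => (hud _).mono hUr) Metric.isOpen_ball
  have hhre : ∀ z ∈ U, 0 ≤ (h z).re := fun z hz => by
    refine ge_of_tendsto' ((Complex.continuous_re.tendsto _).comp (hhl.tendsto_at hz)) fun k => ?_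
    simp only [Function.comp_apply, Complex.inv_re]
    exact div_nonneg (zero_le_one.trans (hvre _ z (hUr hz))) (Complex.normSq_nonneg _)
  refine ⟨φ, hφ, ?_⟩
  by_cases hz : ∃ z ∈ U, h z = 0
  · right
    obtain ⟨z₀, hz₀, h0⟩ := hz
    have hzero : ∀ z ∈ U, h z = 0 := by
      rcases (hhd.analyticOnNhd Metric.isOpen_ball).is_constant_or_isOpen
        (convex_ball a (r / 2)).isPreconnected with ⟨w, hw⟩ | hopen
      · exact fun z hz => by rw [hw z hz, ← hw z₀ hz₀, h0]
      · exfalso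
        obtain ⟨δ, hδ, hsub⟩ := Metric.isOpen_iff.1 (hopen U subset_rfl Metric.isOpen_ball) 0
          ⟨z₀, hz₀, h0⟩
        obtain ⟨z, hz, he⟩ := hsub (show ((-(δ / 2) : ℝ) : ℂ) ∈ Metric.ball 0 δ by
          rw [mem_ball_zero_iff, Complex.norm_real, Real.norm_eq_abs, abs_neg,
            abs_of_pos (by positivity)]
          linarith)
        have := hhre z hz
        rw [he, Complex.ofReal_re] at this
        linarith
    intro L hL _ C
    have hpos : 0 < (|C| + |c - 1| + 1)⁻¹ := by positivity
    filter_upwards [Metric.tendstoUniformlyOn_iff.1 hh _ hpos] with k hk z hz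
    have h1 := hk z (hL hz)
    rw [hzero z (hL hz), dist_zero_left, norm_inv] at h1
    have h2 := (inv_lt_inv₀ (norm_pos_iff.2 (hv0 (φ k) z (hUr (hL hz)))) (by positivity)).1 h1
    have h3 : ‖v (φ k) z‖ ≤ ‖g (φ k) z‖ + |c - 1| := by
      refine (norm_sub_le _ _).trans ?_
      rw [Complex.norm_real, Real.norm_eq_abs]
    linarith [le_abs_self C]
  · left
    push Not at hz
    refine ⟨fun z => (h z)⁻¹ + (c - 1 : ℝ), ?_⟩
    have hinv := hhl.inv₀ hhd.continuousOn hz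
    rw [Metric.tendstoLocallyUniformlyOn_iff] at hinv ⊢
    intro δ hδ x hx
    obtain ⟨t, ht, htk⟩ := hinv δ hδ x hx
    refine ⟨t, ht, htk.mono fun k hk y hy => ?_⟩
    have := hk y hy
    rw [dist_eq_norm] at this ⊢
    convert this using 2
    simp only [hv, Pi.inv_apply, inv_inv]
    ring

theorem differentiable_iterate_expMap (a : ℂ) (n : ℕ) : Differentiable ℂ (expMap a)^[n] := by
  refine Differentiable.iterate ?_ n
  unfold expMap
  fun_prop

theorem exists_iterate_re_lt_of_mem_juliaSet {a : ℂ} (ha : a ∈ juliaSet (expMap a)) {ε : ℝ}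
    (hε : 0 < ε) (c : ℝ) : ∃ n : ℕ, ∃ p ∈ Metric.ball a ε, ((expMap a)^[n + 1] p).re < c := by
  by_contra! hcon
  refine ha ⟨Metric.ball a (ε / 2), Metric.isOpen_ball,
    ((convex_ball _ _).isConnected ⟨a, Metric.mem_ball_self (by positivity)⟩),
    Metric.mem_ball_self (by positivity), isNormalFamilyOn_of_le_re hε (c := c) ?_ ?_⟩
  · rintro _ ⟨n, _, rfl⟩
    exact (differentiable_iterate_expMap a n).differentiableOn
  · rintro _ ⟨n, hn, rfl⟩ z hz
    obtain ⟨m, rfl⟩ := Nat.exists_eq_add_of_le' hn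
    exact hcon m z hz

/-! ### Growth radii and the bounded clopen piece. -/

/-- The sequence `ρ, e^ρ + |a|, …` dominating the iterated maximum modulus of `z ↦ e^z + a`. -/
noncomputable def expRadius (a : ℂ) (ρ : ℝ) : ℕ → ℝ
  | 0 => ρ
  | n + 1 => Real.exp (expRadius a ρ n) + ‖a‖

theorem le_expRadius (a : ℂ) (ρ : ℝ) (n : ℕ) : ρ ≤ expRadius a ρ n := by
  induction n with
  | zero => exact le_rfl
  | succ n ih =>
    have := Real.add_one_le_exp (expRadius a ρ n)
    simp only [expRadius]
    linarith [norm_nonneg a]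

theorem norm_expMap_le (a z : ℂ) : ‖expMap a z‖ ≤ Real.exp ‖z‖ + ‖a‖ := by
  refine (norm_add_le _ _).trans ?_
  rw [Complex.norm_exp]
  gcongr
  exact Complex.re_le_norm z

theorem maxModulus_expMap_le (a : ℂ) (x : ℝ) : maxModulus (expMap a) x ≤ Real.exp x + ‖a‖ := by
  refine Real.sSup_le ?_ (by positivity)
  rintro _ ⟨z, hz, rfl⟩
  rw [mem_sphere_zero_iff_norm] at hz
  rw [← hz]
  exact norm_expMap_le a z

theorem iterate_maxModulus_le_expRadius {a : ℂ} {R ρ : ℝ} (h : R ≤ ρ) (n : ℕ) :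
    (maxModulus (expMap a))^[n] R ≤ expRadius a ρ n := by
  induction n with
  | zero => exact h
  | succ n ih =>
    rw [Function.iterate_succ_apply']
    refine (maxModulus_expMap_le a _).trans ?_
    simp only [expRadius]
    gcongr

theorem norm_iterate_lt_expRadius {a z : ℂ} {ρ : ℝ} {k n : ℕ} (hkn : k ≤ n)
    (h : ‖(expMap a)^[k] z‖ < expRadius a ρ k) : ‖(expMap a)^[n] z‖ < expRadius a ρ n := by
  induction n, hkn using Nat.le_induction with
  | base => exact h
  | succ n _ ih =>
    rw [Function.iterate_succ_apply']
    refine (norm_expMap_le a _).trans_lt ?_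
    simp only [expRadius]
    gcongr

/-- Given a bounded logarithm based at the singular value, the part of the set of points staying
away from it that escapes slower than `expRadius a ρ` splits off a bounded clopen piece containing
the disc of radius `ρ`. -/
theorem exists_bounded_locally_constant {a : ℂ} {ε : ℝ} (hε : 0 < ε)
    (h : HasBoundedLog (farOrbitSet a ε) a) (ρ₀ : ℝ) :
    ∃ ρ, ρ₀ ≤ ρ ∧ ∃ V : Set ℂ, Bornology.IsBounded V ∧
      (∀ z ∈ farOrbitSet a ε, ‖z‖ < ρ → z ∈ V) ∧
      ∀ z ∈ farOrbitSet a ε, (∃ k, ‖(expMap a)^[k] z‖ < expRadius a ρ k) →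
        ∀ᶠ w in 𝓝[farOrbitSet a ε] z, (w ∈ V ↔ z ∈ V) := by
  obtain ⟨ℓ, hℓc, ⟨B, hB⟩, hℓ⟩ := h
  set X := farOrbitSet a ε with hX
  set f := expMap a with hf
  have hfX : ∀ n, Set.MapsTo f^[n] X X := fun n z hz => iterate_mem_farOrbitSet hz n
  have hf1 : Set.MapsTo f X X := hfX 1
  have hfc : Continuous f := continuous_expMap a
  set μ : ℂ → ℝ := fun z => (z - ℓ (f z)).im with hμ
  have hμc : ContinuousOn μ X := Complex.continuous_im.comp_continuousOn
    (continuousOn_id.sub (hℓc.comp hfc.continuousOn hf1))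
  have hμZ : ∀ z ∈ X, ∃ m : ℤ, μ z = m * (2 * Real.pi) := fun z hz => by
    have h1 : Complex.exp z = Complex.exp (ℓ (f z)) := by
      rw [hℓ _ (hf1 hz), hf, expMap, add_sub_cancel_right]
    obtain ⟨m, hm⟩ := Complex.exp_eq_exp_iff_exists_int.1 h1
    refine ⟨m, ?_⟩
    have h2 : z - ℓ (f z) = m * (2 * Real.pi * Complex.I) := by
      linear_combination hm
    simp only [hμ, h2]
    simp
  have hμl : ∀ z ∈ X, ∀ᶠ w in 𝓝[X] z, μ w = μ z := fun z hz => by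
    filter_upwards [Metric.tendsto_nhds.1 (hμc z hz) (2 * Real.pi) Real.two_pi_pos,
      self_mem_nhdsWithin] with w hw hwX
    obtain ⟨m, hm⟩ := hμZ z hz
    obtain ⟨m', hm'⟩ := hμZ w hwX
    rw [Real.dist_eq, hm, hm', ← sub_mul, abs_mul, abs_of_pos Real.two_pi_pos] at hw
    have h1 : |(m' - m : ℝ)| < 1 := by
      by_contra hle
      have := mul_le_mul_of_nonneg_right (not_lt.1 hle) Real.two_pi_pos.le
      linarith
    have h2 : m' = m := by
      have : |m' - m| < 1 := by exact_mod_cast h1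
      have := Int.abs_lt_one_iff.1 this
      omega
    rw [hm, hm', h2]
  -- Large enough that 2r_{n+1} + 2 + 2B + |log ε|, the norm bound on G (n + 1), is below 4e^{r_n} -
  -- |a|.
  set ρ := max ρ₀ (3 * ‖a‖ + 2 + 2 * |B| + |Real.log ε|) with hρ
  have hρ' : 3 * ‖a‖ + 2 + 2 * |B| + |Real.log ε| ≤ ρ := le_max_right _ _
  set r := expRadius a ρ with hr
  have hρr : ∀ n, ρ ≤ r n := le_expRadius a ρ
  have hr0 : ∀ n, 0 ≤ r n := fun n => by
    have := hρr n
    linarith [norm_nonneg a, abs_nonneg B, abs_nonneg (Real.log ε)]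
  set G : ℕ → Set ℂ := fun n => {z | |μ z| ≤ r n + B ∧ z.re < r n + 2} with hG
  have hGmem : ∀ n, ∀ z ∈ X, ‖z‖ < r n → z ∈ G n := fun n z hz hlt => by
    refine ⟨?_, ?_⟩
    · have h1 := hB _ (hf1 hz)
      have h2 := (Complex.abs_im_le_norm z).trans hlt.le
      simp only [hμ, Complex.sub_im]
      exact (abs_sub _ _).trans (add_le_add h2 h1)
    · linarith [Complex.re_le_norm z]
  have hGnorm : ∀ n, ∀ z ∈ X, z ∈ G n → ‖z‖ ≤ 2 * r n + 2 + 2 * B + |Real.log ε| :=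
    fun n z hz hzG => by
      have h1 : |z.re| ≤ r n + 2 + |Real.log ε| := by
        rw [abs_le]
        have := log_le_re_of_mem_farOrbitSet hε hz
        constructor
        · linarith [neg_abs_le (Real.log ε), hr0 n]
        · linarith [hzG.2, abs_nonneg (Real.log ε)]
      have h2 : |z.im| ≤ r n + 2 * B := by
        have e : z.im = μ z + (ℓ (f z)).im := by simp [hμ]
        rw [e]
        refine (abs_add_le _ _).trans ?_
        linarith [hzG.1, hB _ (hf1 hz)]
      linarith [Complex.norm_le_abs_re_add_abs_im z]
  -- If Re z ≥ r_n + 2, then |f z| ≥ e²e^{r_n} - |a| ≥ 4e^{r_n} - |a|, too large for G (n + 1). So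
  -- only the locally constant condition on μ can fail.
  have hGstep : ∀ n, ∀ z ∈ X, z ∉ G n → f z ∈ G (n + 1) → r n + B < |μ z| :=
    fun n z hz hzG hfz => by
      by_contra hle
      have hre : r n + 2 ≤ z.re := by
        by_contra hlt
        exact hzG ⟨not_lt.1 hle, not_le.1 hlt⟩
      have h1 := hGnorm _ _ (hf1 hz) hfz
      have h2 : Real.exp z.re - ‖a‖ ≤ ‖f z‖ := by
        have h3 := norm_expMap_sub a z
        have h4 := norm_sub_le (expMap a z) a
        rw [← h3]
        linarith
      have h3 : 4 * Real.exp (r n) ≤ Real.exp z.re := by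
        refine le_trans ?_ (Real.exp_le_exp.2 hre)
        rw [Real.exp_add, mul_comm]
        gcongr
        have e : Real.exp 2 = Real.exp 1 * Real.exp 1 := by rw [← Real.exp_add]; norm_num
        have := Real.add_one_le_exp 1
        nlinarith
      have h4 := Real.add_one_le_exp (r n)
      have h5 := hρr n
      have h6 : r (n + 1) = Real.exp (r n) + ‖a‖ := rfl
      rw [h6] at h1
      linarith [le_abs_self B, hr0 n]
  refine ⟨ρ, le_max_left _ _, {z | z ∈ X ∧ ∀ n, f^[n] z ∈ G n}, ?_, ?_, ?_⟩
  · refine isBounded_iff_forall_norm_le.2 ⟨_, fun z hz => hGnorm 0 z hz.1 (hz.2 0)⟩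
  · exact fun z hz hlt => ⟨hz, fun n => hGmem n _ (hfX n hz)
      (norm_iterate_lt_expRadius (Nat.zero_le n) hlt)⟩
  · rintro z hz ⟨k, hk⟩
    have hiter : ∀ n, Tendsto f^[n] (𝓝[X] z) (𝓝[X] (f^[n] z)) := fun n =>
      ((hfc.iterate n).continuousWithinAt).tendsto_nhdsWithin (hfX n)
    have hlate : ∀ w ∈ X, ‖f^[k] w‖ < r k → ∀ n, k ≤ n → f^[n] w ∈ G n := fun w hw hlt n hn =>
      hGmem n _ (hfX n hw) (norm_iterate_lt_expRadius hn hlt)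
    by_cases hzV : z ∈ {z | z ∈ X ∧ ∀ n, f^[n] z ∈ G n}
    · have h1 : ∀ᶠ w in 𝓝[X] z, ‖f^[k] w‖ < r k :=
        (((hfc.iterate k).norm.tendsto z).mono_left nhdsWithin_le_nhds).eventually_lt_const hk
      have h2 : ∀ᶠ w in 𝓝[X] z, ∀ n ∈ Finset.range k, f^[n] w ∈ G n := by
        rw [Filter.eventually_all_finset]
        intro n _
        have h3 : ∀ᶠ w in 𝓝[X] z, (f^[n] w).re < r n + 2 :=
          (((Complex.continuous_re.comp (hfc.iterate n)).tendsto z).mono_left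
            nhdsWithin_le_nhds).eventually_lt_const (hzV.2 n).2
        filter_upwards [h3, (hiter n).eventually (hμl _ (hfX n hz))] with w hw3 hw4
        exact ⟨by rw [hw4]; exact (hzV.2 n).1, hw3⟩
      filter_upwards [h1, h2, self_mem_nhdsWithin] with w hw1 hw2 hwX
      refine iff_of_true ⟨hwX, fun n => ?_⟩ hzV
      rcases lt_or_ge n k with hn | hn
      · exact hw2 n (Finset.mem_range.2 hn)
      · exact hlate w hwX hw1 n hn
    -- Iterates from time k on lie in their boxes, so a failure must be followed by a re-entry.
    · have hj : ∃ j, f^[j] z ∉ G j ∧ f^[j + 1] z ∈ G (j + 1) := by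
        by_contra! hcon
        refine hzV ⟨hz, fun n => ?_⟩
        have hup : ∀ m, f^[n + m] z ∉ G (n + m) ∨ f^[n] z ∈ G n := fun m => by
          induction m with
          | zero => exact (em _).symm
          | succ m ih => exact ih.imp_left fun h => hcon _ h
        exact (hup k).resolve_left fun h => h (hlate z hz hk _ (Nat.le_add_left _ _))
      obtain ⟨j, hj, hj1⟩ := hj
      rw [Function.iterate_succ_apply'] at hj1
      have hlt := hGstep j _ (hfX j hz) hj hj1
      filter_upwards [(hiter j).eventually (hμl _ (hfX j hz))] with w hw
      refine iff_of_false (fun hwV => ?_) hzV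
      have := (hwV.2 j).1
      rw [hw] at this
      exact absurd hlt (not_lt.2 this)

/-! ### Separation on the sphere. -/

theorem avoidingSet_subset_farOrbitSet (a : ℂ) (ε : ℝ) :
    avoidingSet (expMap a) a ε ⊆ farOrbitSet a ε := fun _ hz n =>
  (le_of_lt hz).trans (ciInf_le ⟨0, by rintro _ ⟨m, rfl⟩; exact norm_nonneg _⟩ n)

theorem mainTheorem7 (a : ℂ) (ha : a ∈ juliaSet (expMap a)) (ε R : ℝ) (hε : 0 < ε) (hR : 0 < R)
    (z₀ : ℂ) (hz₀ : z₀ ∈ avoidingSet (expMap a) a ε) :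
    Separates
      (((↑) : ℂ → OnePoint ℂ) ''
        (fastEscapingSet (expMap a) R ∪ (avoidingSet (expMap a) a ε)ᶜ))
      (z₀ : OnePoint ℂ) OnePoint.infty := by
  -- ρ ≥ R makes every point outside A_R slow; ρ > |z₀| covers z₀ even if it lies in A_R, and puts
  -- it in V.
  obtain ⟨ρ, hρ, V, hVb, hVmem, hVl⟩ := exists_bounded_locally_constant hε
    (hasBoundedLog_farOrbitSet hε (exists_iterate_re_lt_of_mem_juliaSet ha hε)) (max R (‖z₀‖ + 1))
  have hRρ : R ≤ ρ := (le_max_left _ _).trans hρ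
  have hz₀ρ : ‖z₀‖ < ρ := (lt_add_one _).trans_le ((le_max_right _ _).trans hρ)
  have hz₀X := avoidingSet_subset_farOrbitSet a ε hz₀
  set Y : Set (OnePoint ℂ) := (Set.range ((↑) : ℂ → OnePoint ℂ) \
    (((↑) : ℂ → OnePoint ℂ) '' (fastEscapingSet (expMap a) R ∪ (avoidingSet (expMap a) a ε)ᶜ))) ∪
    {(z₀ : OnePoint ℂ), OnePoint.infty} with hY
  have hYfin : ∀ z : ℂ, (z : OnePoint ℂ) ∈ Y → z ∈ farOrbitSet a ε ∧
      ∃ k, ‖(expMap a)^[k] z‖ < expRadius a ρ k := by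
    rintro z (⟨-, hz⟩ | hz | hz)
    · have hz' : z ∉ fastEscapingSet (expMap a) R ∪ (avoidingSet (expMap a) a ε)ᶜ :=
        fun h => hz ⟨z, h, rfl⟩
      rw [Set.mem_union, not_or, Set.notMem_compl_iff] at hz'
      refine ⟨avoidingSet_subset_farOrbitSet a ε hz'.2, ?_⟩
      by_contra! hcon
      exact hz'.1 fun n => (iterate_maxModulus_le_expRadius hRρ n).trans (hcon n)
    · rw [OnePoint.coe_eq_coe] at hz
      subst hz
      exact ⟨hz₀X, 0, hz₀ρ⟩
    · exact absurd hz (OnePoint.coe_ne_infty z)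
  set U : Set Y := {x | (x : OnePoint ℂ) ∈ ((↑) : ℂ → OnePoint ℂ) '' V} with hU
  have hUl : ∀ x : Y, ∀ᶠ x' in 𝓝 x, (x' ∈ U ↔ x ∈ U) := by
    rintro ⟨x, hx⟩
    have hval := (continuous_subtype_val (p := fun y => y ∈ Y)).tendsto ⟨x, hx⟩
    induction x using OnePoint.rec with
    | infty =>
      obtain ⟨C, hC⟩ := isBounded_iff_forall_norm_le.1 hVb
      have hopen : IsOpen (((↑) : ℂ → OnePoint ℂ) '' Metric.closedBall (0 : ℂ) C)ᶜ :=
        OnePoint.isOpen_compl_image_coe.2 ⟨Metric.isClosed_closedBall, isCompact_closedBall _ _⟩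
      filter_upwards [hval.eventually (hopen.mem_nhds (OnePoint.infty_notMem_image_coe))] with x' hx'
      refine iff_of_false ?_ OnePoint.infty_notMem_image_coe
      rintro ⟨w, hw, he⟩
      exact hx' ⟨w, by simpa using hC w hw, he⟩
    | coe z =>
      obtain ⟨hzX, hk⟩ := hYfin z hx
      have h1 := eventually_nhdsWithin_iff.1 (hVl z hzX hk)
      have h2 : ∀ᶠ y : OnePoint ℂ in 𝓝 (z : OnePoint ℂ), ∀ w : ℂ,
          y = (w : OnePoint ℂ) → w ∈ farOrbitSet a ε → (w ∈ V ↔ z ∈ V) := by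
        rw [OnePoint.nhds_coe_eq, eventually_map]
        filter_upwards [h1] with w hw w' hw' hwX
        rw [OnePoint.coe_eq_coe] at hw'
        exact hw' ▸ hw (hw' ▸ hwX)
      have hmem : ∀ w : ℂ, (w : OnePoint ℂ) ∈ ((↑) : ℂ → OnePoint ℂ) '' V ↔ w ∈ V := fun w =>
        OnePoint.coe_injective.mem_set_image
      filter_upwards [hval.eventually h2,
        hval.eventually (OnePoint.isOpenEmbedding_coe.isOpen_range.mem_nhds ⟨z, rfl⟩)]
        with ⟨x', hx'⟩ hx2 ⟨w, hw⟩
      subst hw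
      simp only [hU, Set.mem_ofPred_eq, hmem]
      exact hx2 w rfl (hYfin w hx').1
  refine ⟨U, ⟨⟨?_⟩, ?_⟩, ⟨z₀, hVmem z₀ hz₀X hz₀ρ, rfl⟩, OnePoint.infty_notMem_image_coe⟩
  · exact isOpen_iff_mem_nhds.2 fun x hx => (hUl x).mono fun x' h h' => hx (h.1 h')
  · exact isOpen_iff_mem_nhds.2 fun x hx => (hUl x).mono fun x' h => h.2 hx
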